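/- Let $q_j=\exp((2j-1)\pi i/4)\in\mathbb C$ for $1\le j\le 4$, and let $K_0$ be the closed square with vertices $q_1,\dots,q_4$. For an odd integer $l\ge 3$ put $S_l=\{2nl^{-1}q_j:\ 0\le n\le (l-1)/2,\ 1\le j\le 4\}$ and, for $w\in S_l$, $F^l_w(z)=w+l^{-1}z$ ($z\in\mathbb C$). For a sequence $\bm l=(l_k)_{k\ge1}$ of odd integers $l_k\ge 3$, the scale-irregular Vicsek set is $$K^{\bm l}=\bigcap_{n=1}^\infty\ \bigcup_{w_1\in S_{l_1},\dots,w_n\in S_{l_n}} F^{l_1}_{w_1}\circ\cdots\circ F^{l_n}_{w_n}(K_0).$$ **Theorem.** Let $3\le a<b$ be odd integers and let $\bm l=(l_k)_{k\ge1}$ be a sequence with $l_k\in\{a,b\}$ for all $k$. Let $[n]_a$ and $[n]_b$ be the numbers of indices $1\le j\le n$ with $l_j=a$ and $l_j=b$, respectively, let $\theta_n=[n]_a/[n]_b$, and suppose that the limit $\theta=\lim_{n\to\infty}\theta_n\in[0,\infty)$ exists. Let $\eta_n=n(\theta_n-\theta)$. Suppose that one of the following two conditions holds, with limits taken in $[-\infty,\infty]$: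 1. $\liminf_{n\to\infty}\eta_n=\infty$; 2. $\liminf_{n\to\infty}\eta_n\in\mathbb R$ and $\limsup_{n\to\infty}\eta_n=\infty$. Then $K^{\bm l}$ is not self-similar: there is no finite family of maps $f_1,\dots,f_m:\mathbb C\to\mathbb C$ that are contracting similitudes (that is, $|f_i(x)-f_i(y)|=r_i|x-y|$ for all $x,y\in\mathbb C$ with some $0<r_i<1$) and whose attractor is $K^{\bm l}$, i.e. such that $K^{\bm l}$ is a nonempty compact set with $K^{\bm l}=\bigcup_{i=1}^m f_i(K^{\bm l})$. -/

import Mathlib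

open Set Filter Topology

noncomputable section

/-- The four corners `q_{j+1} = exp((2(j+1) - 1)πi/4)`, `j = 0, 1, 2, 3`, of the square `K₀`. -/
def vicsekCorner (j : Fin 4) : ℂ :=
  Complex.exp ((2 * ((j : ℕ) : ℂ) + 1) * Real.pi * Complex.I / 4)

/-- The closed (filled) square `K₀` with vertices `q₁, q₂, q₃, q₄`. -/
def vicsekSquare : Set ℂ := convexHull ℝ (Set.range vicsekCorner)

/-- The digit set `S_l = {2 n l⁻¹ q_j : 0 ≤ n ≤ (l - 1) / 2, 1 ≤ j ≤ 4}`; the bound on `n` is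
written as `2 n + 1 ≤ l`. -/
def vicsekDigits (l : ℕ) : Set ℂ :=
  {w | ∃ n : ℕ, 2 * n + 1 ≤ l ∧ ∃ j : Fin 4, w = 2 * (n : ℂ) * (l : ℂ)⁻¹ * vicsekCorner j}

/-- The map `F_w^l(z) = w + l⁻¹ z`. -/
def vicsekMap (l : ℕ) (w z : ℂ) : ℂ := w + (l : ℂ)⁻¹ * z

/-- The words `w_1 ⋯ w_n` with `w_k ∈ S_{l_k}`. Sequences are indexed from `0` here, so that
`l k` is the `(k + 1)`-st term `l_{k+1}` of the sequence. -/
def vicsekWords (l : ℕ → ℕ) (n : ℕ) : Set (Fin n → ℂ) :=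
  {w | ∀ k : Fin n, w k ∈ vicsekDigits (l k)}

/-- The composition `F_{w_1}^{l_1} ∘ ⋯ ∘ F_{w_n}^{l_n}`. -/
def vicsekWordMap (l : ℕ → ℕ) : (n : ℕ) → (Fin n → ℂ) → ℂ → ℂ
  | 0, _ => id
  | n + 1, w => vicsekWordMap l n (Fin.init w) ∘ vicsekMap (l n) (w (Fin.last n))

/-- The scale-irregular Vicsek set
`K^l = ⋂_{n ≥ 1} ⋃_{w a word of length n} F_{w_1}^{l_1} ∘ ⋯ ∘ F_{w_n}^{l_n} (K₀)`. -/
def vicsekSet (l : ℕ → ℕ) : Set ℂ :=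
  ⋂ n ≥ 1, ⋃ w ∈ vicsekWords l n, vicsekWordMap l n w '' vicsekSquare

/-- `[n]_a`: the number of occurrences of `a` among the first `n` terms of the sequence. -/
def digitCount (l : ℕ → ℕ) (a n : ℕ) : ℕ := ((Finset.range n).filter fun j => l j = a).card

/-- `θ_n = [n]_a / [n]_b`. (Only the behaviour for large `n` is used; as soon as `b` has occurred
in the sequence the denominator is positive.) -/
def freqRatio (l : ℕ → ℕ) (a b n : ℕ) : ℝ := (digitCount l a n : ℝ) / (digitCount l b n : ℝ)

/-- `η_n = n (θ_n - θ)`. -/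
def freqDeviation (l : ℕ → ℕ) (a b : ℕ) (θ : ℝ) (n : ℕ) : ℝ := n * (freqRatio l a b n - θ)

/-- `K` is the attractor of the family `f` of maps: the nonempty compact set that is the union of
its images. -/
def IsAttractor {X ι : Type*} [TopologicalSpace X] (f : ι → X → X) (K : Set X) : Prop :=
  K.Nonempty ∧ IsCompact K ∧ K = ⋃ i, f i '' K

/-- A subset of the plane is self-similar if it is the attractor of an iterated function system
consisting of finitely many contracting similitudes, i.e. maps `f` of the plane to itself with
`|f x - f y| = r |x - y|` for all `x, y`, for some ratio `0 < r < 1`. -/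
def IsSelfSimilar (K : Set ℂ) : Prop :=
  ∃ (m : ℕ) (f : Fin m → ℂ → ℂ),
    (∀ i, ∃ r : ℝ, 0 < r ∧ r < 1 ∧ ∀ x y : ℂ, dist (f i x) (f i y) = r * dist x y) ∧
    IsAttractor f K

end

/-! Let `L_n` be the product of the first `n` terms of the sequence and `N_n` the product of the
numbers `2 l_k - 1`. The set has `N_n` cells of level `n`, of size about `1 / L_n`, and `N_n` is
essentially its packing number at scale `1 / L_n`: the cell centres form a packing
(`hasPacking_vicsekSet`), and no packing at a scale above `2 / L_n` is larger
(`HasPacking.le_card_cellCenters`).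

Packing numbers of a self-similar set are supermultiplicative up to a constant loss `c` of scale,
because a small copy of the set can be placed at each point of a packing
(`IsSelfSimilar.exists_hasPacking_mul`). Taking `k`-th powers of the level-`n` packing and letting
`k` tend to infinity gives `log N_n ≤ s (log L_n + C)` for all `n`, where `s = lim log N_m / log
L_m` and `C = -log c`.

On the other hand `log N_n - s log L_n = α [n]_b (θ_n - θ)` with `α = log (2a - 1) - s log a`, and
`α > 0` because `log (2x - 1) / log x` is strictly decreasing for `x > 1`. Since `η_n = (θ_n + 1)
[n]_b (θ_n - θ)`, the bound makes `η_n` bounded above for large `n`, whereas either condition forces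
`limsup η_n = ∞`. -/

/-! ### Packings of self-similar sets -/

/-- `K` contains `N` points that are pairwise at distance at least `r`. -/
def HasPacking {X : Type*} [PseudoMetricSpace X] (K : Set X) (r : ℝ) (N : ℕ) : Prop :=
  ∃ T : Finset X, (T : Set X) ⊆ K ∧ T.card = N ∧ (T : Set X).Pairwise fun x y => r ≤ dist x y

theorem HasPacking.mono {X : Type*} [PseudoMetricSpace X] {K : Set X} {r r' : ℝ} {N : ℕ}
    (h : HasPacking K r N) (hr : r' ≤ r) : HasPacking K r' N := by
  obtain ⟨T, hT, hN, hd⟩ := h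
  exact ⟨T, hT, hN, fun x hx y hy hxy => hr.trans (hd hx hy hxy)⟩

/-- Follow an address of `x` and stop as soon as the product of the ratios is at most `t`; the last
factor is at least `p`, so the product is at least `p * t`. The condition `q ^ k ≤ t` bounds the
depth by `k`. -/
theorem exists_similitude_ratio_mem_Icc {X ι : Type*} [PseudoMetricSpace X] {K : Set X}
    {f : ι → X → X} {r : ι → ℝ} {p q : ℝ} (hp : 0 < p) (hp1 : p ≤ 1)
    (hpr : ∀ i, p ≤ r i) (hrq : ∀ i, r i ≤ q)
    (hf : ∀ i x y, dist (f i x) (f i y) = r i * dist x y) (hK : K = ⋃ i, f i '' K) (k : ℕ) :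
    ∀ t : ℝ, t ≤ 1 → q ^ k ≤ t → ∀ x ∈ K, ∃ (φ : X → X) (ρ : ℝ), p * t ≤ ρ ∧ ρ ≤ t ∧
      x ∈ φ '' K ∧ φ '' K ⊆ K ∧ ∀ y z, dist (φ y) (φ z) = ρ * dist y z := by
  induction k with
  | zero =>
    intro t ht1 ht x hx
    have ht : t = 1 := le_antisymm ht1 (by simpa using ht)
    subst ht
    exact ⟨id, 1, by simpa using hp1, le_rfl, by simpa using hx, by simp, by simp⟩
  | succ k ih =>
    intro t ht1 ht x hx
    have hx' := hx
    rw [hK, mem_iUnion] at hx'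
    obtain ⟨i, y, hy, rfl⟩ := hx'
    have hi : 0 < r i := hp.trans_le (hpr i)
    have hiK : f i '' K ⊆ K := fun z hz => by rw [hK]; exact mem_iUnion.2 ⟨i, hz⟩
    rcases le_or_gt (r i) t with h | h
    · refine ⟨f i, r i, ?_, h, mem_image_of_mem _ hy, hiK, hf i⟩
      exact (mul_le_of_le_one_right hp.le ht1).trans (hpr i)
    · have hq : 0 < q := hi.trans_le (hrq i)
      obtain ⟨φ, ρ, h1, h2, h3, h4, h5⟩ := ih (t / r i) ((div_le_one hi).2 h.le) (by
        rw [le_div_iff₀ hi]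
        refine le_trans ?_ ht
        rw [pow_succ]
        exact mul_le_mul_of_nonneg_left (hrq i) (pow_nonneg hq.le k)) y hy
      refine ⟨f i ∘ φ, r i * ρ, ?_, ?_, ?_, ?_, ?_⟩
      · have := mul_le_mul_of_nonneg_left h1 hi.le
        have e : r i * (p * (t / r i)) = p * t := by field_simp
        linarith
      · have := mul_le_mul_of_nonneg_left h2 hi.le
        have e : r i * (t / r i) = t := by field_simp
        linarith
      · rw [image_comp]; exact mem_image_of_mem _ h3
      · rw [image_comp]; exact (image_mono h4).trans hiK
      · intro y z
        simp only [Function.comp, hf, h5]; ring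

/-- Through each point of the `r`-packing runs a copy of `K` of ratio at most `r / (4 * D)`, hence
of diameter at most `r / 4`. Points in copies at different centres stay `r / 2` apart; within one
copy the `δ`-packing shrinks by at least `p * r / (4 * D)`. -/
theorem HasPacking.mul {X : Type*} [PseudoMetricSpace X] {K : Set X} {p D : ℝ} (hp : 0 < p)
    (hp1 : p ≤ 1) (hD : 1 ≤ D) (hKD : ∀ x ∈ K, ∀ y ∈ K, dist x y ≤ D)
    (h : ∀ t : ℝ, 0 < t → t ≤ 1 → ∀ x ∈ K, ∃ (φ : X → X) (ρ : ℝ), p * t ≤ ρ ∧ ρ ≤ t ∧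
      x ∈ φ '' K ∧ φ '' K ⊆ K ∧ ∀ y z, dist (φ y) (φ z) = ρ * dist y z)
    {r δ : ℝ} {M N : ℕ} (hr : 0 < r) (hr1 : r ≤ 1) (hδ : 0 < δ) (hδ1 : δ ≤ 1)
    (hM : HasPacking K r M) (hN : HasPacking K δ N) :
    HasPacking K (p / (4 * D) * r * δ) (M * N) := by
  classical
  obtain ⟨S, hSK, rfl, hS⟩ := hM
  obtain ⟨T, hTK, rfl, hT⟩ := hN
  have hD0 : 0 < D := by linarith
  choose! φ ρ h1 h2 h3 h4 h5 using h (r / (4 * D)) (by positivity)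
    (by rw [div_le_one (by positivity)]; linarith)
  have hpos : 0 < p / (4 * D) * r * δ := by positivity
  have key : ∀ u ∈ S ×ˢ T, ∀ v ∈ S ×ˢ T, u ≠ v →
      p / (4 * D) * r * δ ≤ dist (φ u.1 u.2) (φ v.1 v.2) := by
    rintro ⟨x, y⟩ hu ⟨x', y'⟩ hv huv
    simp only [Finset.mem_product] at hu hv
    simp only
    by_cases hx : x = x'
    · subst hx
      have hy : y ≠ y' := fun e => huv (by rw [e])
      rw [h5 x (hSK hu.1)]
      have e : p / (4 * D) * r * δ = p * (r / (4 * D)) * δ := by ring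
      rw [e]
      exact mul_le_mul (h1 x (hSK hu.1)) (hT hu.2 hv.2 hy) hδ.le
        (le_trans (by positivity) (h1 x (hSK hu.1)))
    · have near : ∀ z ∈ S, ∀ w ∈ T, dist z (φ z w) ≤ r / 4 := by
        intro z hz w hw
        obtain ⟨z', hz', e⟩ := h3 z (hSK hz)
        calc dist z (φ z w) = ρ z * dist z' w := by rw [← h5 z (hSK hz), e]
          _ ≤ r / (4 * D) * D := mul_le_mul (h2 z (hSK hz)) (hKD _ hz' _ (hTK hw)) dist_nonneg
            (by positivity)
          _ = r / 4 := by field_simp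
      have a1 := near x hu.1 y hu.2
      have a2 := near x' hv.1 y' hv.2
      have a3 := hS hu.1 hv.1 hx
      have a4 := dist_triangle4 x (φ x y) (φ x' y') x'
      rw [dist_comm (φ x' y') x'] at a4
      have a5 : p / (4 * D) * r * δ ≤ 1 / 4 * r * 1 := by
        have : p / (4 * D) ≤ 1 / 4 := by
          rw [div_le_div_iff₀ (by positivity) (by norm_num)]; linarith
        gcongr
      simp only at a3
      linarith
  refine ⟨(S ×ˢ T).image fun u => φ u.1 u.2, ?_, ?_, ?_⟩
  · intro z hz
    simp only [Finset.coe_image, mem_image, Finset.mem_coe, Finset.mem_product] at hz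
    obtain ⟨u, hu, rfl⟩ := hz
    exact h4 u.1 (hSK hu.1) (mem_image_of_mem _ (hTK hu.2))
  · rw [Finset.card_image_of_injOn, Finset.card_product]
    intro u hu v hv huv
    by_contra hne
    have := key u hu v hv hne
    simp only at huv
    rw [huv, dist_self] at this
    linarith
  · intro z hz w hw hzw
    simp only [Finset.coe_image, mem_image, Finset.mem_coe] at hz hw
    obtain ⟨u, hu, rfl⟩ := hz
    obtain ⟨v, hv, rfl⟩ := hw
    exact key u hu v hv fun e => hzw (by rw [e])

theorem IsSelfSimilar.exists_hasPacking_mul {K : Set ℂ} (h : IsSelfSimilar K) :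
    ∃ c : ℝ, 0 < c ∧ c ≤ 1 ∧ ∀ (r δ : ℝ) (M N : ℕ), 0 < r → r ≤ 1 → 0 < δ → δ ≤ 1 →
      HasPacking K r M → HasPacking K δ N → HasPacking K (c * r * δ) (M * N) := by
  obtain ⟨m, f, hf, hne, hc, hK⟩ := h
  choose r hr0 hr1 hf using hf
  have : Nonempty (Fin m) := by
    obtain ⟨x, hx⟩ := hne
    rw [hK, mem_iUnion] at hx
    exact ⟨hx.choose⟩
  obtain ⟨i, hi⟩ := Finite.exists_min r
  obtain ⟨j, hj⟩ := Finite.exists_max r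
  obtain ⟨D, hD⟩ := Metric.isBounded_iff.1 hc.isBounded
  have hD1 : (1 : ℝ) ≤ max D 1 := le_max_right _ _
  refine ⟨r i / (4 * max D 1), by have := hr0 i; positivity, ?_, ?_⟩
  · rw [div_le_one (by positivity)]
    linarith [hr1 i]
  · intro ρ δ M N h1 h2 h3 h4 h5 h6
    refine HasPacking.mul (hr0 i) (hr1 i).le hD1
      (fun x hx y hy => (hD hx hy).trans (le_max_left _ _)) ?_ h1 h2 h3 h4 h5 h6
    intro t ht0 ht1
    obtain ⟨k, hk⟩ := exists_pow_lt_of_lt_one ht0 (hr1 j)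
    exact exists_similitude_ratio_mem_Icc (hr0 i) (hr1 i).le hi hj hf hK k t ht1 hk.le

/-- The loss is one factor `c` per power, with `c` independent of `r` and `N`; per power it costs
only the constant `-log c` on the logarithmic scale. -/
theorem IsSelfSimilar.exists_hasPacking_pow {K : Set ℂ} (h : IsSelfSimilar K) :
    ∃ c : ℝ, 0 < c ∧ c ≤ 1 ∧ ∀ (r : ℝ) (N : ℕ), 0 < r → r ≤ 1 → HasPacking K r N →
      ∀ k : ℕ, HasPacking K ((c * r) ^ (k + 1)) (N ^ (k + 1)) := by
  obtain ⟨c, hc0, hc1, hc⟩ := h.exists_hasPacking_mul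
  refine ⟨c, hc0, hc1, fun r N hr0 hr1 hN k => ?_⟩
  have hcr : c * r ≤ 1 := by nlinarith
  induction k with
  | zero => simpa using hN.mono (show c * r ≤ r by nlinarith)
  | succ k ih =>
    have := hc _ _ _ _ (pow_pos (mul_pos hc0 hr0) (k + 1))
      (pow_le_one₀ (by positivity) hcr) hr0 hr1 ih hN
    convert this using 1
    · rw [pow_succ]; ring
    · rw [pow_succ]

/-! ### Corners, the square and the cell maps -/

theorem vicsekCorner_eq (j : Fin 4) :
    vicsekCorner j = Complex.I ^ (j : ℕ) * vicsekCorner 0 := by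
  have hI : Complex.I = Complex.exp (Real.pi / 2 * Complex.I) := by
    rw [Complex.exp_pi_div_two_mul_I]
  unfold vicsekCorner
  rw [show Complex.I ^ (j : ℕ) = Complex.exp ((j : ℕ) * (Real.pi / 2 * Complex.I)) by
    rw [Complex.exp_nat_mul, ← hI], ← Complex.exp_add]
  congr 1
  simp only [Fin.val_zero, Nat.cast_zero]
  ring

theorem norm_vicsekCorner (j : Fin 4) : ‖vicsekCorner j‖ = 1 := by
  have : vicsekCorner j = Complex.exp (((2 * ((j : ℕ) : ℝ) + 1) * Real.pi / 4 : ℝ) * Complex.I) := by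
    unfold vicsekCorner
    congr 1
    push_cast
    ring
  rw [this, Complex.norm_exp_ofReal_mul_I]

theorem convex_vicsekSquare : Convex ℝ vicsekSquare := convex_convexHull ℝ _

theorem vicsekCorner_mem_vicsekSquare (j : Fin 4) : vicsekCorner j ∈ vicsekSquare :=
  subset_convexHull ℝ _ (mem_range_self j)

theorem zero_mem_vicsekSquare : (0 : ℂ) ∈ vicsekSquare := by
  have h := convex_vicsekSquare (vicsekCorner_mem_vicsekSquare 0)
    (vicsekCorner_mem_vicsekSquare 2) (a := 1 / 2) (b := 1 / 2) (by norm_num) (by norm_num)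
    (by norm_num)
  rw [vicsekCorner_eq 2] at h
  simpa using h

theorem norm_le_one_of_mem_vicsekSquare {z : ℂ} (hz : z ∈ vicsekSquare) : ‖z‖ ≤ 1 := by
  have : vicsekSquare ⊆ Metric.closedBall 0 1 := by
    refine convexHull_min ?_ (convex_closedBall 0 1)
    rintro _ ⟨j, rfl⟩
    simp [norm_vicsekCorner]
  simpa using this hz

theorem vicsekMap_mem_vicsekSquare {l : ℕ} {w z : ℂ} (hw : w ∈ vicsekDigits l)
    (hz : z ∈ vicsekSquare) : vicsekMap l w z ∈ vicsekSquare := by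
  obtain ⟨n, hn, j, rfl⟩ := hw
  have hl : (0 : ℝ) < l := by exact_mod_cast (by omega : 0 < l)
  have hn' : 2 * (n : ℝ) + 1 ≤ l := by exact_mod_cast hn
  have hsum : 2 * (n : ℝ) / l + (l : ℝ)⁻¹ ≤ 1 := by
    rw [← one_div, ← add_div, div_le_one hl]; exact hn'
  have h0 : 0 ≤ 2 * (n : ℝ) / l := by positivity
  have h1 : (0 : ℝ) ≤ (l : ℝ)⁻¹ := by positivity
  -- The image point is a convex combination of `q_j`, `z` and the centre `0`, which takes the
  -- remaining weight.
  have h := convex_vicsekSquare.sum_mem (t := Finset.univ)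
    (w := ![2 * (n : ℝ) / l, (l : ℝ)⁻¹, 1 - (2 * (n : ℝ) / l + (l : ℝ)⁻¹)])
    (z := ![vicsekCorner j, z, 0])
    (by intro i _; fin_cases i <;> simp <;> first | exact h0 | linarith)
    (by simp [Fin.sum_univ_three])
    (by intro i _
        fin_cases i
        · exact vicsekCorner_mem_vicsekSquare j
        · exact hz
        · exact zero_mem_vicsekSquare)
  simp only [Fin.sum_univ_three, Matrix.cons_val_zero, Matrix.cons_val_one, Matrix.cons_val,
    Complex.real_smul] at h
  convert h using 1
  unfold vicsekMap
  push_cast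
  ring

theorem vicsekWordMap_snoc (l : ℕ → ℕ) (n : ℕ) (w : Fin n → ℂ) (v z : ℂ) :
    vicsekWordMap l (n + 1) (Fin.snoc w v) z = vicsekWordMap l n w (vicsekMap (l n) v z) := by
  rw [vicsekWordMap, Function.comp, Fin.init_snoc, Fin.snoc_last]

theorem zero_mem_vicsekDigits {l : ℕ} (hl : 1 ≤ l) : (0 : ℂ) ∈ vicsekDigits l :=
  ⟨0, by omega, 0, by simp⟩

/-! ### Gaussian-integer coordinates of the cells -/

/-- The Gaussian integers on the coordinate axes with coordinates at most `l / 2`: the digit set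
`S_l` in the coordinate `2 l⁻¹ q₁`. -/
noncomputable def crossDigits (l : ℕ) : Finset GaussianInt :=
  (Finset.Icc (-((l / 2 : ℕ) : ℤ)) ((l / 2 : ℕ) : ℤ)).image (fun x => (⟨x, 0⟩ : GaussianInt)) ∪
    (Finset.Icc (-((l / 2 : ℕ) : ℤ)) ((l / 2 : ℕ) : ℤ)).image (fun y => (⟨0, y⟩ : GaussianInt))

theorem mem_crossDigits {l : ℕ} {g : GaussianInt} :
    g ∈ crossDigits l ↔ (|g.re| ≤ (l / 2 : ℕ) ∧ g.im = 0) ∨ (g.re = 0 ∧ |g.im| ≤ (l / 2 : ℕ)) := by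
  obtain ⟨x, y⟩ := g
  simp only [crossDigits, Finset.mem_union, Finset.mem_image, Finset.mem_Icc, Zsqrtd.mk.injEq,
    abs_le]
  constructor
  · rintro (⟨u, hu, rfl, rfl⟩ | ⟨u, hu, rfl, rfl⟩)
    · exact Or.inl ⟨hu, rfl⟩
    · exact Or.inr ⟨rfl, hu⟩
  · rintro (⟨hu, rfl⟩ | ⟨rfl, hu⟩)
    · exact Or.inl ⟨x, hu, rfl, rfl⟩
    · exact Or.inr ⟨y, hu, rfl, rfl⟩

theorem card_crossDigits {l : ℕ} (hl : Odd l) : (crossDigits l).card = 2 * l - 1 := by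
  obtain ⟨h, rfl⟩ := hl
  have e : (2 * h + 1) / 2 = h := by omega
  have key := Finset.card_union_add_card_inter
    ((Finset.Icc (-(h : ℤ)) h).image (fun x => (⟨x, 0⟩ : GaussianInt)))
    ((Finset.Icc (-(h : ℤ)) h).image (fun x => (⟨0, x⟩ : GaussianInt)))
  have hint : (Finset.Icc (-(h : ℤ)) h).image (fun x => (⟨x, 0⟩ : GaussianInt)) ∩
      (Finset.Icc (-(h : ℤ)) h).image (fun x => (⟨0, x⟩ : GaussianInt)) = {0} := by
    ext ⟨x, y⟩
    simp only [Finset.mem_inter, Finset.mem_image, Finset.mem_Icc,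
      Finset.mem_singleton, Zsqrtd.ext_iff, Zsqrtd.re_zero, Zsqrtd.im_zero]
    constructor
    · rintro ⟨⟨u, -, -, rfl⟩, ⟨v, -, rfl, -⟩⟩
      exact ⟨rfl, rfl⟩
    · rintro ⟨rfl, rfl⟩
      exact ⟨⟨0, by omega, rfl, rfl⟩, ⟨0, by omega, rfl, rfl⟩⟩
  rw [hint, Finset.card_singleton, Finset.card_image_of_injective _ fun x y hxy => by
      simpa using hxy, Finset.card_image_of_injective _ fun x y hxy => by simpa using hxy,
    Int.card_Icc] at key
  unfold crossDigits
  rw [e]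
  omega

open GaussianInt in
theorem mem_vicsekDigits_iff {l : ℕ} (hl : Odd l) {w : ℂ} :
    w ∈ vicsekDigits l ↔
      ∃ g ∈ crossDigits l, w = 2 * toComplex g * (l : ℂ)⁻¹ * vicsekCorner 0 := by
  obtain ⟨h, hh⟩ := hl
  have e : l / 2 = h := by omega
  have hmem (n : ℕ) : 2 * n + 1 ≤ l ↔ n ≤ h := by omega
  simp only [vicsekDigits, mem_ofPred_eq, mem_crossDigits, e, hmem]
  constructor
  · rintro ⟨n, hn, j, rfl⟩
    have hn' : |(n : ℤ)| ≤ h := by rw [Nat.abs_cast]; exact_mod_cast hn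
    rw [vicsekCorner_eq]
    fin_cases j
    · exact ⟨⟨n, 0⟩, Or.inl ⟨hn', rfl⟩, by simp [toComplex_def]⟩
    · exact ⟨⟨0, n⟩, Or.inr ⟨rfl, hn'⟩, by simp [toComplex_def]; ring⟩
    · exact ⟨⟨-n, 0⟩, Or.inl ⟨by simpa using hn, rfl⟩, by simp [toComplex_def]⟩
    · exact ⟨⟨0, -n⟩, Or.inr ⟨rfl, by simpa using hn⟩, by
        simp [toComplex_def, Complex.I_pow_three]; ring⟩
  · rintro ⟨⟨x, y⟩, hg, rfl⟩
    have hcases (u : ℤ) (hu : |u| ≤ h) : ∃ n : ℕ, n ≤ h ∧ (u = n ∨ u = -n) :=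
      ⟨u.natAbs, by have := abs_le.1 hu; omega, by omega⟩
    rcases hg with ⟨hx, hy⟩ | ⟨hx, hy⟩
    · obtain ⟨n, hn, hx⟩ := hcases x hx
      simp only at hy
      rcases hx with rfl | rfl
      · exact ⟨n, hn, 0, by simp [toComplex_def, hy]⟩
      · exact ⟨n, hn, 2, by rw [vicsekCorner_eq 2]; simp [toComplex_def, hy]⟩
    · obtain ⟨n, hn, hy⟩ := hcases y hy
      simp only at hx
      rcases hy with rfl | rfl
      · exact ⟨n, hn, 1, by rw [vicsekCorner_eq 1]; simp [toComplex_def, hx]; ring⟩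
      · exact ⟨n, hn, 3, by
          rw [vicsekCorner_eq 3]; simp [toComplex_def, hx, Complex.I_pow_three]; ring⟩

/-- The centres of the cells of level `n`, in the coordinate `2 (l_1 ⋯ l_n)⁻¹ q₁`. -/
noncomputable def cellCenters (l : ℕ → ℕ) : ℕ → Finset GaussianInt
  | 0 => {0}
  | n + 1 => (cellCenters l n ×ˢ crossDigits (l n)).image fun u => (l n : GaussianInt) * u.1 + u.2

theorem Int.eq_of_mul_add_eq_mul_add {h u v x y : ℤ} (hx : |x| ≤ h) (hy : |y| ≤ h)
    (e : (2 * h + 1) * u + x = (2 * h + 1) * v + y) : x = y := by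
  have hd : (2 * h + 1) ∣ x - y := ⟨v - u, by linarith⟩
  have := Int.eq_zero_of_abs_lt_dvd hd (by
    have := abs_sub x y
    linarith)
  linarith

/-- For odd `l = 2h + 1` both coordinates of a digit lie in `[-h, h]`, a complete residue system
modulo `l`, so the digit and then the quotient can be recovered. -/
theorem injOn_mul_add_crossDigits {l : ℕ} (hl : Odd l) (E : Set GaussianInt) :
    InjOn (fun u : GaussianInt × GaussianInt => (l : GaussianInt) * u.1 + u.2)
      (E ×ˢ (crossDigits l : Set GaussianInt)) := by
  rintro ⟨p, x⟩ ⟨-, hx⟩ ⟨q, y⟩ ⟨-, hy⟩ e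
  simp only [Finset.mem_coe] at hx hy
  obtain ⟨h, hh⟩ := hl
  have hbound {g : GaussianInt} (hg : g ∈ crossDigits l) : |g.re| ≤ h ∧ |g.im| ≤ h := by
    have e : l / 2 = h := by omega
    rw [mem_crossDigits, e] at hg
    rcases hg with ⟨h1, h2⟩ | ⟨h1, h2⟩
    · exact ⟨h1, by simp [h2]⟩
    · exact ⟨by simp [h1], h2⟩
  have hl0 : (l : ℤ) = 2 * h + 1 := by exact_mod_cast hh
  simp only [Zsqrtd.ext_iff, Zsqrtd.re_add, Zsqrtd.im_add, Zsqrtd.re_mul, Zsqrtd.im_mul,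
    Zsqrtd.re_natCast, Zsqrtd.im_natCast, hl0] at e
  obtain ⟨e1, e2⟩ := e
  have r1 := Int.eq_of_mul_add_eq_mul_add (hbound hx).1 (hbound hy).1 (u := p.re) (v := q.re)
    (by linarith)
  have r2 := Int.eq_of_mul_add_eq_mul_add (hbound hx).2 (hbound hy).2 (u := p.im) (v := q.im)
    (by linarith)
  have hpos : (2 * (h : ℤ) + 1) ≠ 0 := by omega
  have r3 : p.re = q.re := mul_left_cancel₀ hpos (by linarith)
  have r4 : p.im = q.im := mul_left_cancel₀ hpos (by linarith)
  exact Prod.ext (Zsqrtd.ext r3 r4) (Zsqrtd.ext r1 r2)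

theorem card_cellCenters {l : ℕ → ℕ} (hl : ∀ k, Odd (l k)) (n : ℕ) :
    (cellCenters l n).card = ∏ k ∈ Finset.range n, (2 * l k - 1) := by
  induction n with
  | zero => simp [cellCenters]
  | succ n ih =>
    rw [cellCenters, Finset.card_image_of_injOn, Finset.card_product, ih, card_crossDigits (hl n),
      Finset.prod_range_succ]
    rw [Finset.coe_product]
    exact injOn_mul_add_crossDigits (hl n) _

/-- The number `l_1 ⋯ l_n`, the inverse of the ratio of the cells of level `n`. -/
def cellScale (l : ℕ → ℕ) (n : ℕ) : ℕ := ∏ k ∈ Finset.range n, l k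

theorem cellScale_pos {l : ℕ → ℕ} (hl : ∀ k, Odd (l k)) (n : ℕ) : 0 < cellScale l n :=
  Finset.prod_pos fun k _ => (hl k).pos

/-- The point of the plane that corresponds to an element of `cellCenters l n`. -/
noncomputable def cellPoint (l : ℕ → ℕ) (n : ℕ) (g : GaussianInt) : ℂ :=
  2 * GaussianInt.toComplex g * (cellScale l n : ℂ)⁻¹ * vicsekCorner 0

theorem cellPoint_succ {l : ℕ → ℕ} (hl : ∀ k, Odd (l k)) (n : ℕ) (p g : GaussianInt) (z : ℂ) :
    cellPoint l n p + (cellScale l n : ℂ)⁻¹ *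
        vicsekMap (l n) (2 * GaussianInt.toComplex g * (l n : ℂ)⁻¹ * vicsekCorner 0) z =
      cellPoint l (n + 1) (l n * p + g) + (cellScale l (n + 1) : ℂ)⁻¹ * z := by
  have h1 : (l n : ℂ) ≠ 0 := by exact_mod_cast (hl n).pos.ne'
  have h2 : (cellScale l n : ℂ) ≠ 0 := by exact_mod_cast (cellScale_pos hl n).ne'
  have h3 : (cellScale l (n + 1) : ℂ) = cellScale l n * l n := by
    simp [cellScale, Finset.prod_range_succ]
  unfold cellPoint vicsekMap
  rw [h3, map_add, map_mul, map_natCast]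
  field_simp
  ring

theorem exists_cellCenter_of_mem_vicsekWords {l : ℕ → ℕ} (hl : ∀ k, Odd (l k)) (n : ℕ) :
    ∀ w ∈ vicsekWords l n, ∃ g ∈ cellCenters l n, ∀ z,
      vicsekWordMap l n w z = cellPoint l n g + (cellScale l n : ℂ)⁻¹ * z := by
  induction n with
  | zero => intro w _; exact ⟨0, by simp [cellCenters], by simp [vicsekWordMap, cellPoint, cellScale]⟩
  | succ n ih =>
    intro w hw
    obtain ⟨p, hp, hpz⟩ := ih (Fin.init w) fun k => hw k.castSucc
    obtain ⟨g, hg, hgz⟩ := (mem_vicsekDigits_iff (hl n)).1 (by simpa using hw (Fin.last n))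
    refine ⟨l n * p + g, ?_, fun z => ?_⟩
    · exact Finset.mem_image.2 ⟨(p, g), Finset.mem_product.2 ⟨hp, hg⟩, rfl⟩
    · rw [vicsekWordMap, Function.comp, hpz, hgz, cellPoint_succ hl]

theorem exists_mem_vicsekWords_of_cellCenter {l : ℕ → ℕ} (hl : ∀ k, Odd (l k)) (n : ℕ) :
    ∀ g ∈ cellCenters l n, ∃ w ∈ vicsekWords l n, ∀ z,
      vicsekWordMap l n w z = cellPoint l n g + (cellScale l n : ℂ)⁻¹ * z := by
  induction n with
  | zero =>
    intro g hg
    have hg : g = 0 := by simpa [cellCenters] using hg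
    exact ⟨0, fun k => k.elim0, by simp [vicsekWordMap, cellPoint, cellScale, hg]⟩
  | succ n ih =>
    intro g hg
    obtain ⟨⟨p, d⟩, hpd, rfl⟩ := Finset.mem_image.1 hg
    obtain ⟨hp, hd⟩ := Finset.mem_product.1 hpd
    obtain ⟨w, hw, hwz⟩ := ih p hp
    refine ⟨Fin.snoc w (2 * GaussianInt.toComplex d * (l n : ℂ)⁻¹ * vicsekCorner 0), ?_, ?_⟩
    · intro k
      refine Fin.lastCases ?_ (fun k => ?_) k
      · simpa using (mem_vicsekDigits_iff (hl n)).2 ⟨d, hd, rfl⟩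
      · simpa using hw k
    · intro z
      rw [vicsekWordMap_snoc, hwz, cellPoint_succ hl]

/-- Since `0` is a digit at every level, a cell centre remains a centre at all deeper levels (`up`);
since the cells are nested (`down`), this puts it in every term of the intersection. -/
theorem cellPoint_mem_vicsekSet {l : ℕ → ℕ} (hl : ∀ k, Odd (l k)) {n : ℕ} {g : GaussianInt}
    (hg : g ∈ cellCenters l n) : cellPoint l n g ∈ vicsekSet l := by
  have up (m : ℕ) : ∃ w ∈ vicsekWords l (n + m), vicsekWordMap l (n + m) w 0 = cellPoint l n g := by
    induction m with
    | zero =>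
      obtain ⟨w, hw, h⟩ := exists_mem_vicsekWords_of_cellCenter hl n g hg
      exact ⟨w, hw, by simp [h]⟩
    | succ m ih =>
      obtain ⟨w, hw, h⟩ := ih
      refine ⟨Fin.snoc w 0, fun k => ?_, ?_⟩
      · refine Fin.lastCases ?_ (fun k => ?_) k
        · simpa using zero_mem_vicsekDigits (hl (n + m)).pos
        · simpa using hw k
      · refine (vicsekWordMap_snoc l (n + m) w 0 0).trans ?_
        simpa [vicsekMap] using h
  have down (m k : ℕ) (x : ℂ) (h : x ∈ ⋃ w ∈ vicsekWords l (m + k),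
      vicsekWordMap l (m + k) w '' vicsekSquare) :
      x ∈ ⋃ w ∈ vicsekWords l m, vicsekWordMap l m w '' vicsekSquare := by
    induction k with
    | zero => exact h
    | succ k ih =>
      refine ih ?_
      simp only [mem_iUnion, exists_prop] at h ⊢
      obtain ⟨w, hw, z, hz, rfl⟩ := h
      refine ⟨Fin.init w, fun i => hw i.castSucc, ?_⟩
      exact mem_image_of_mem _
        (vicsekMap_mem_vicsekSquare (by simpa using hw (Fin.last (m + k))) hz)
  refine mem_iInter₂.2 fun m _ => down m n _ ?_
  obtain ⟨w, hw, h⟩ := up m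
  rw [Nat.add_comm m n]
  exact mem_iUnion₂.2 ⟨w, hw, 0, zero_mem_vicsekSquare, h⟩

/-! ### Packing numbers of the Vicsek set -/

theorem one_le_norm_toComplex {g : GaussianInt} (hg : g ≠ 0) :
    1 ≤ ‖GaussianInt.toComplex g‖ := by
  have h : 0 < Zsqrtd.norm g := GaussianInt.norm_pos.2 hg
  have h1 : (1 : ℝ) ≤ ((Zsqrtd.norm g : ℤ) : ℝ) := by exact_mod_cast h
  rw [GaussianInt.intCast_real_norm, Complex.normSq_eq_norm_sq] at h1
  exact (one_le_sq_iff₀ (norm_nonneg _)).1 h1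

theorem inv_cellScale_le_dist_cellPoint {l : ℕ → ℕ} (n : ℕ)
    {p q : GaussianInt} (hpq : p ≠ q) :
    (cellScale l n : ℝ)⁻¹ ≤ dist (cellPoint l n p) (cellPoint l n q) := by
  have e : cellPoint l n p - cellPoint l n q = cellPoint l n (p - q) := by
    unfold cellPoint; rw [map_sub]; ring
  rw [dist_eq_norm, e, cellPoint]
  simp only [norm_mul, norm_inv, Complex.norm_natCast, norm_vicsekCorner, Complex.norm_ofNat]
  have h1 := one_le_norm_toComplex (sub_ne_zero.2 hpq)
  have h2 : (0 : ℝ) ≤ (cellScale l n : ℝ)⁻¹ := by positivity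
  nlinarith

theorem hasPacking_vicsekSet {l : ℕ → ℕ} (hl : ∀ k, Odd (l k)) (n : ℕ) :
    HasPacking (vicsekSet l) (cellScale l n : ℝ)⁻¹ (cellCenters l n).card := by
  have hpos : (0 : ℝ) < (cellScale l n : ℝ)⁻¹ := by
    have := cellScale_pos hl n
    positivity
  refine ⟨(cellCenters l n).image (cellPoint l n), ?_, ?_, ?_⟩
  · intro x hx
    obtain ⟨g, hg, rfl⟩ := Finset.mem_image.1 hx
    exact cellPoint_mem_vicsekSet hl hg
  · refine Finset.card_image_of_injective _ fun p q hpq => ?_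
    by_contra hne
    have := inv_cellScale_le_dist_cellPoint (l := l) n hne
    rw [hpq, dist_self] at this
    linarith
  · intro x hx y hy hxy
    obtain ⟨p, -, rfl⟩ := Finset.mem_image.1 hx
    obtain ⟨q, -, rfl⟩ := Finset.mem_image.1 hy
    exact inv_cellScale_le_dist_cellPoint n fun e => hxy (by rw [e])

/-- Each point lies within `1 / L_n` of a centre, so two points sharing a centre are at most `2 /
L_n < r` apart. -/
theorem HasPacking.le_card_cellCenters {l : ℕ → ℕ} (hl : ∀ k, Odd (l k)) {n : ℕ} (hn : 1 ≤ n)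
    {r : ℝ} {N : ℕ} (h : HasPacking (vicsekSet l) r N) (hr : 2 < cellScale l n * r) :
    N ≤ (cellCenters l n).card := by
  obtain ⟨T, hT, rfl, hd⟩ := h
  have hpos : (0 : ℝ) < cellScale l n := by exact_mod_cast cellScale_pos hl n
  have key : ∀ x ∈ T, ∃ g ∈ cellCenters l n,
      dist x (cellPoint l n g) ≤ (cellScale l n : ℝ)⁻¹ := by
    intro x hx
    have := mem_iInter₂.1 (hT hx) n hn
    simp only [mem_iUnion, exists_prop] at this
    obtain ⟨w, hw, z, hz, rfl⟩ := this
    obtain ⟨g, hg, h⟩ := exists_cellCenter_of_mem_vicsekWords hl n w hw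
    refine ⟨g, hg, ?_⟩
    rw [h, dist_eq_norm, add_sub_cancel_left, norm_mul, norm_inv, Complex.norm_natCast]
    exact mul_le_of_le_one_right (by positivity) (norm_le_one_of_mem_vicsekSquare hz)
  choose! g hg hgd using key
  refine Finset.card_le_card_of_injOn g (fun x hx => hg x hx) fun x hx y hy hxy => ?_
  by_contra hne
  have h1 := hgd x hx
  have h2 := hgd y hy
  rw [← hxy] at h2
  have h3 := dist_triangle_right x y (cellPoint l n (g x))
  have h4 := hd hx hy hne
  have h5 : r ≤ 2 * (cellScale l n : ℝ)⁻¹ := by linarith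
  have h6 : cellScale l n * r ≤ cellScale l n * (2 * (cellScale l n : ℝ)⁻¹) := by gcongr
  have h7 : (cellScale l n : ℝ) * (2 * (cellScale l n : ℝ)⁻¹) = 2 := by field_simp
  linarith

/-! ### Logarithmic estimates -/

/-- With `p = log b / log a > 1`, so that `a ^ p = b`, strict convexity of `x ^ p` at the midpoint
`a` of `1` and `2a - 1` gives `2b - 1 < (2a - 1) ^ p`. -/
theorem log_mul_log_lt_log_mul_log {a b : ℝ} (ha : 1 < a) (hab : a < b) :
    Real.log (2 * b - 1) * Real.log a < Real.log (2 * a - 1) * Real.log b := by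
  have hla : 0 < Real.log a := Real.log_pos ha
  have hlab : Real.log a < Real.log b := Real.log_lt_log (by linarith) hab
  have hp : 1 < Real.log b / Real.log a := (one_lt_div hla).2 hlab
  have hb : a ^ (Real.log b / Real.log a) = b := by
    rw [Real.rpow_def_of_pos (by linarith), mul_div_cancel₀ _ hla.ne', Real.exp_log (by linarith)]
  have h := (strictConvexOn_rpow hp).right (show (1 : ℝ) ∈ Ici 0 by simp)
    (show 2 * a - 1 ∈ Ici (0 : ℝ) by simp only [mem_Ici]; linarith) (by linarith)
    (show (0 : ℝ) < 1 / 2 by norm_num) (show (0 : ℝ) < 1 / 2 by norm_num) (by norm_num)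
  simp only [smul_eq_mul, Real.one_rpow] at h
  rw [show (1 / 2 * 1 + 1 / 2 * (2 * a - 1) : ℝ) = a by ring, hb] at h
  have h1 : 2 * b - 1 < (2 * a - 1) ^ (Real.log b / Real.log a) := by linarith
  have h2 := Real.log_lt_log (by linarith) h1
  rw [Real.log_rpow (by linarith), div_mul_eq_mul_div, lt_div_iff₀ hla] at h2
  linarith

theorem digitCount_succ (l : ℕ → ℕ) (c n : ℕ) :
    digitCount l c (n + 1) = digitCount l c n + if l n = c then 1 else 0 := by
  unfold digitCount
  rw [Finset.range_add_one, Finset.filter_insert]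
  split_ifs
  · rw [Finset.card_insert_of_notMem (by simp)]
  · rfl

theorem digitCount_mono (l : ℕ → ℕ) (c : ℕ) : Monotone (digitCount l c) :=
  monotone_nat_of_le_succ fun n => by rw [digitCount_succ]; exact Nat.le_add_right _ _

theorem sum_eq_digitCount_mul_add {l : ℕ → ℕ} {a b : ℕ} (hab : a ≠ b)
    (hl : ∀ k, l k = a ∨ l k = b) (h : ℕ → ℝ) (n : ℕ) :
    ∑ k ∈ Finset.range n, h (l k) = digitCount l a n * h a + digitCount l b n * h b := by
  induction n with
  | zero => simp [digitCount]
  | succ n ih =>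
    rw [Finset.sum_range_succ, ih, digitCount_succ, digitCount_succ]
    rcases hl n with e | e
    · simp only [e, if_true, if_neg hab]; push_cast; ring
    · simp only [e, if_true, if_neg hab.symm]; push_cast; ring

theorem log_cellScale {l : ℕ → ℕ} (hl : ∀ k, Odd (l k)) (n : ℕ) :
    Real.log (cellScale l n) = ∑ k ∈ Finset.range n, Real.log (l k) := by
  unfold cellScale
  rw [Nat.cast_prod, Real.log_prod]
  intro k _
  exact_mod_cast (hl k).pos.ne'

theorem log_card_cellCenters {l : ℕ → ℕ} (hl : ∀ k, Odd (l k)) (n : ℕ) :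
    Real.log (cellCenters l n).card = ∑ k ∈ Finset.range n, Real.log (2 * (l k : ℝ) - 1) := by
  have e (k : ℕ) : ((2 * l k - 1 : ℕ) : ℝ) = 2 * (l k : ℝ) - 1 := by
    have := (hl k).pos
    rw [Nat.cast_sub (by omega)]
    push_cast
    ring
  rw [card_cellCenters hl, Nat.cast_prod, Real.log_prod]
  · exact Finset.sum_congr rfl fun k _ => by rw [e]
  · intro k _
    have := (hl k).pos
    exact_mod_cast (by omega : 2 * l k - 1 ≠ 0)

/-- If `u m / v m → s`, where `v` tends to infinity with bounded increments, and `u m ≥ k x`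
as soon as `v m > k R + E`, then `x ≤ s R`. -/
theorem le_mul_of_tendsto_div_of_forall_mul_le {u v : ℕ → ℝ} {s d E R x : ℝ} (hs : 0 ≤ s)
    (hE : 0 ≤ E) (hR : 0 ≤ R) (hd : 0 ≤ d)
    (hvd : ∀ n, v (n + 1) ≤ v n + d) (hv : Tendsto v atTop atTop)
    (huv : Tendsto (fun n => u n / v n) atTop (𝓝 s))
    (h : ∀ k m : ℕ, 1 ≤ m → (k + 1) * R + E < v m → (k + 1) * x ≤ u m) : x ≤ s * R := by
  refine le_of_forall_pos_le_add fun ε hε => ?_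
  have hδ : 0 < ε / (R + 1) := by positivity
  set δ := ε / (R + 1) with hδdef
  have hδR : δ * R ≤ ε := by
    rw [hδdef, div_mul_eq_mul_div, div_le_iff₀ (by positivity)]
    nlinarith
  obtain ⟨M, hM⟩ := eventually_atTop.1 ((huv.eventually (gt_mem_nhds
    (show s < s + δ by linarith))).and ((hv.eventually_gt_atTop 0).and (eventually_ge_atTop 1)))
  have hM0 := (hM M le_rfl).2.1
  have bound (k : ℕ) : (k + 1) * x ≤ (s + δ) * ((k + 1) * R + E + v M + d) := by
    have hX : 0 ≤ (k + 1) * R + E := by positivity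
    have hex : ∃ j, (k + 1) * R + E < v (M + j) := by
      obtain ⟨m, hm1, hm2⟩ :=
        ((hv.eventually_gt_atTop ((k + 1) * R + E)).and (eventually_ge_atTop M)).exists
      exact ⟨m - M, by rwa [Nat.add_sub_cancel' hm2]⟩
    classical
    -- At the first index from `M` on where `v` passes the threshold, it overshoots by at most `d`,
    -- unless that index is `M` itself; adding `v M` covers this case.
    have hj := Nat.find_spec hex
    have hmin : v (M + Nat.find hex) ≤ (k + 1) * R + E + v M + d := by
      rcases hcase : Nat.find hex with _ | i
      · rw [Nat.add_zero]; linarith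
      · have := Nat.find_min hex (m := i) (by omega)
        have h2 := hvd (M + i)
        rw [← Nat.add_assoc]
        linarith
    obtain ⟨h1, h2, h3⟩ := hM (M + Nat.find hex) (Nat.le_add_right _ _)
    rw [div_lt_iff₀ h2] at h1
    calc (k + 1) * x ≤ u (M + Nat.find hex) := h k _ h3 hj
      _ ≤ (s + δ) * v (M + Nat.find hex) := h1.le
      _ ≤ _ := mul_le_mul_of_nonneg_left hmin (by positivity)
  -- Growth in `k` eliminates the constants `E`, `v M` and `d`.
  have main : x ≤ (s + δ) * R := by
    by_contra! hlt
    obtain ⟨k, hk⟩ := exists_nat_gt ((s + δ) * (E + v M + d) / (x - (s + δ) * R))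
    rw [div_lt_iff₀ (by linarith)] at hk
    have := bound k
    nlinarith
  linarith

/-! ### Self-similarity against letter frequencies -/

/-- The power packing has `N_n ^ (k + 1)` points at scale `(c / L_n) ^ (k + 1)`, so `N_m` is at
least as large once `log L_m > (k + 1) (log L_n - log c) + log 2`. -/
theorem IsSelfSimilar.exists_log_card_cellCenters_le {l : ℕ → ℕ} (hl : ∀ k, Odd (l k)) {b : ℕ}
    (hl3 : ∀ k, 3 ≤ l k) (hlb : ∀ k, l k ≤ b) {s : ℝ} (hs : 0 ≤ s)
    (hlim : Tendsto (fun n => Real.log (cellCenters l n).card / Real.log (cellScale l n))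
      atTop (𝓝 s)) (h : IsSelfSimilar (vicsekSet l)) :
    ∃ C : ℝ, 0 ≤ C ∧ ∀ n,
      Real.log (cellCenters l n).card ≤ s * (Real.log (cellScale l n) + C) := by
  obtain ⟨c, hc0, hc1, hc⟩ := h.exists_hasPacking_pow
  have hL (n : ℕ) : (1 : ℝ) ≤ cellScale l n := by exact_mod_cast cellScale_pos hl n
  have hC : 0 ≤ -Real.log c := by linarith [Real.log_nonpos hc0.le hc1]
  refine ⟨-Real.log c, hC, fun n => ?_⟩
  have hl3' (k : ℕ) : (3 : ℝ) ≤ l k := by exact_mod_cast hl3 k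
  have hstep (n : ℕ) :
      Real.log (cellScale l (n + 1)) = Real.log (cellScale l n) + Real.log (l n) := by
    rw [log_cellScale hl, log_cellScale hl, Finset.sum_range_succ]
  refine le_mul_of_tendsto_div_of_forall_mul_le (d := Real.log b) (E := Real.log 2) hs
    (Real.log_nonneg (by norm_num)) (add_nonneg (Real.log_nonneg (hL n)) hC)
    (Real.log_natCast_nonneg b) (fun m => ?_) ?_ hlim fun k m hm hlt => ?_
  · rw [hstep]
    have : Real.log (l m) ≤ Real.log b :=
      Real.log_le_log (by linarith [hl3' m]) (by exact_mod_cast hlb m)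
    linarith
  · have hge (n : ℕ) : n * Real.log 3 ≤ Real.log (cellScale l n) := by
      rw [log_cellScale hl]
      have := Finset.card_nsmul_le_sum (Finset.range n) (fun k => Real.log (l k)) (Real.log 3)
        fun k _ => Real.log_le_log (by norm_num) (hl3' k)
      simpa using this
    exact tendsto_atTop_mono hge
      (tendsto_natCast_atTop_atTop.atTop_mul_const (Real.log_pos (by norm_num)))
  · have hpos : (0 : ℝ) < cellScale l n := by linarith [hL n]
    have hp := hc _ _ (inv_pos.2 hpos) (inv_le_one_of_one_le₀ (hL n)) (hasPacking_vicsekSet hl n) k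
    have hcr : 0 < (c * (cellScale l n : ℝ)⁻¹) ^ (k + 1) := by positivity
    have hle := hp.le_card_cellCenters hl hm (by
      have hposm : (0 : ℝ) < cellScale l m := by linarith [hL m]
      rw [← Real.log_lt_log_iff (by norm_num) (by positivity), Real.log_mul hposm.ne' hcr.ne',
        Real.log_pow, Real.log_mul hc0.ne' (inv_ne_zero hpos.ne'), Real.log_inv]
      push_cast
      linarith)
    have hcard : 0 < (cellCenters l n).card := by
      rw [card_cellCenters hl]
      exact Finset.prod_pos fun k _ => by have := hl3 k; omega
    have := Real.log_le_log (by positivity) (Nat.cast_le (α := ℝ).2 hle)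
    rw [Nat.cast_pow, Real.log_pow] at this
    exact_mod_cast this

theorem theoremt (l : ℕ → ℕ) (a b : ℕ) (ha : Odd a) (hb : Odd b) (ha3 : 3 ≤ a) (hab : a < b)
    (hl : ∀ k, l k = a ∨ l k = b)
    (θ : ℝ) (hθ : Tendsto (fun n => freqRatio l a b n) atTop (𝓝 θ))
    (hη :
      liminf (fun n => (freqDeviation l a b θ n : EReal)) atTop = ⊤ ∨
      ((∃ c : ℝ, liminf (fun n => (freqDeviation l a b θ n : EReal)) atTop = (c : EReal)) ∧
        limsup (fun n => (freqDeviation l a b θ n : EReal)) atTop = ⊤)) :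
    ¬ IsSelfSimilar (vicsekSet l) := by
  intro hss
  have hsup : limsup (fun n => (freqDeviation l a b θ n : EReal)) atTop = ⊤ := by
    rcases hη with h | h
    · exact top_le_iff.1 (h ▸ liminf_le_limsup)
    · exact h.2
  have hfreq (M : ℝ) : ∃ᶠ n in atTop, M < freqDeviation l a b θ n := by
    have := frequently_lt_of_lt_limsup (by isBoundedDefault)
      (show (M : EReal) < limsup (fun n => (freqDeviation l a b θ n : EReal)) atTop by
        rw [hsup]; exact EReal.coe_lt_top M)
    exact this.mono fun n hn => by exact_mod_cast hn
  have hθ0 : 0 ≤ θ := ge_of_tendsto' hθ fun n => by unfold freqRatio; positivity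
  have hodd (k : ℕ) : Odd (l k) := by rcases hl k with e | e <;> rw [e] <;> assumption
  have h3 (k : ℕ) : 3 ≤ l k := by rcases hl k with e | e <;> omega
  have hlb (k : ℕ) : l k ≤ b := by rcases hl k with e | e <;> omega
  -- While `b` has not occurred, division by zero makes the ratio `0`, so the deviation is `-n θ ≤
  -- 0`.
  obtain ⟨n₀, hn₀⟩ : ∃ n, 0 < digitCount l b n := by
    obtain ⟨n, hn⟩ := (hfreq 0).exists
    refine ⟨n, Nat.pos_of_ne_zero fun h0 => ?_⟩
    simp only [freqDeviation, freqRatio, h0, Nat.cast_zero, div_zero] at hn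
    have : 0 ≤ (n : ℝ) * θ := by positivity
    linarith
  have hB : ∀ᶠ n in atTop, (0 : ℝ) < digitCount l b n :=
    (eventually_ge_atTop n₀).mono fun n hn => by
      exact_mod_cast hn₀.trans_le (digitCount_mono l b hn)
  have ha' : (3 : ℝ) ≤ a := by exact_mod_cast ha3
  have hab' : (a : ℝ) < b := by exact_mod_cast hab
  have hla : 0 < Real.log a := Real.log_pos (by linarith)
  have hlb' : 0 < Real.log b := Real.log_pos (by linarith)
  have hla2 : 0 < Real.log (2 * a - 1) := Real.log_pos (by linarith)
  have hlb2 : 0 < Real.log (2 * b - 1) := Real.log_pos (by linarith)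
  have hu (n : ℕ) : Real.log (cellCenters l n).card =
      digitCount l a n * Real.log (2 * a - 1) + digitCount l b n * Real.log (2 * b - 1) := by
    rw [log_card_cellCenters hodd]
    exact sum_eq_digitCount_mul_add hab.ne hl (fun m => Real.log (2 * (m : ℝ) - 1)) n
  have hv (n : ℕ) : Real.log (cellScale l n) =
      digitCount l a n * Real.log a + digitCount l b n * Real.log b := by
    rw [log_cellScale hodd]
    exact sum_eq_digitCount_mul_add hab.ne hl (fun m => Real.log (m : ℝ)) n
  have hn (n : ℕ) : (n : ℝ) = digitCount l a n + digitCount l b n := by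
    simpa using sum_eq_digitCount_mul_add hab.ne hl (fun _ => (1 : ℝ)) n
  have hden : 0 < θ * Real.log a + Real.log b := by positivity
  set s := (θ * Real.log (2 * a - 1) + Real.log (2 * b - 1)) / (θ * Real.log a + Real.log b)
    with hs_def
  have hs : 0 ≤ s := by positivity
  have hs_eq : s * (θ * Real.log a + Real.log b) =
      θ * Real.log (2 * a - 1) + Real.log (2 * b - 1) := div_mul_cancel₀ _ hden.ne'
  have hlim : Tendsto (fun n => Real.log (cellCenters l n).card / Real.log (cellScale l n))
      atTop (𝓝 s) := by
    have := ((hθ.mul_const (Real.log (2 * a - 1))).add_const (Real.log (2 * b - 1))).div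
      ((hθ.mul_const (Real.log a)).add_const (Real.log b)) hden.ne'
    refine this.congr' (hB.mono fun n hn => ?_)
    simp only [Pi.div_apply, hu, hv, freqRatio]
    rw [← mul_div_mul_left _ _ hn.ne']
    congr 1 <;> field_simp
  obtain ⟨C, hC0, hC⟩ := hss.exists_log_card_cellCenters_le hodd h3 hlb hs hlim
  -- `s` is a weighted mean of `log (2a - 1) / log a` and the smaller `log (2b - 1) / log b`, with
  -- positive weight on the latter.
  have hα : 0 < Real.log (2 * a - 1) - s * Real.log a := by
    rw [sub_pos, hs_def, div_mul_eq_mul_div, div_lt_iff₀ hden]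
    have := log_mul_log_lt_log_mul_log (a := a) (b := b) (by linarith) hab'
    nlinarith
  set α := Real.log (2 * a - 1) - s * Real.log a with hα_def
  -- The threshold comes from `α η_n ≤ (θ_n + 1) s C ≤ (θ + 2) s C`, valid once `θ_n < θ + 1`.
  obtain ⟨n, hηn, hBn, hθn⟩ := ((hfreq ((θ + 2) * (s * C) / α)).and_eventually
    (hB.and (hθ.eventually (gt_mem_nhds (show θ < θ + 1 by linarith))))).exists
  have hA : (digitCount l a n : ℝ) = freqRatio l a b n * digitCount l b n := by
    rw [freqRatio, div_mul_cancel₀ _ hBn.ne']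
  have hle := hC n
  rw [hu, hv] at hle
  have hdev : α * (digitCount l b n * (freqRatio l a b n - θ)) ≤ s * C := by
    have : α * (digitCount l b n * (freqRatio l a b n - θ)) =
        digitCount l a n * Real.log (2 * a - 1) + digitCount l b n * Real.log (2 * b - 1) -
          s * (digitCount l a n * Real.log a + digitCount l b n * Real.log b) := by
      rw [hA, hα_def]
      linear_combination (digitCount l b n : ℝ) * hs_eq
    linarith
  rw [div_lt_iff₀ hα, freqDeviation, hn, hA] at hηn
  have hpos : 0 ≤ (θ + 2) * (s * C) := by positivity
  have hθn0 : 0 ≤ freqRatio l a b n := by unfold freqRatio; positivity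
  have e : (freqRatio l a b n * digitCount l b n + digitCount l b n) *
      (freqRatio l a b n - θ) * α =
      (freqRatio l a b n + 1) * (α * (digitCount l b n * (freqRatio l a b n - θ))) := by ring
  rw [e] at hηn
  have h1 : (freqRatio l a b n + 1) * (α * (digitCount l b n * (freqRatio l a b n - θ))) ≤
      (freqRatio l a b n + 1) * (s * C) := by gcongr
  have h2 : (freqRatio l a b n + 1) * (s * C) ≤ (θ + 2) * (s * C) :=
    mul_le_mul_of_nonneg_right (by linarith) (by positivity)
  linarith
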